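/- Let $m>n\ge 3$ be integers and let $S_m\ge S_{m-1}\ge\dots\ge S_1>0$ be real numbers such that $S_m<S_1+S_2+\dots+S_{m-1}$. Then for every $\varepsilon>0$ there is a non-degenerate convex polytope $P\subset\mathbb{R}^n$ (that is, the convex hull of a finite set, with non-empty interior) that has exactly $m$ facets, with facet areas ($(n-1)$-dimensional volumes) $S_1,S_2,\dots,S_m$, and whose volume satisfies $V(P)\le\varepsilon$. Consequently, the infimum of the volumes of all non-degenerate convex polytopes in $\mathbb{R}^n$ with exactly $m$ facets and with facet areas $S_1,\dots,S_m$ is $0$. -/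

import Mathlib

open MeasureTheory
open scoped ENNReal

/-- Non-degenerate convex polytope in `ℝⁿ`: the convex hull of a finite set of points, with
interior points. -/
def IsNondegenerateConvexPolytope {n : ℕ} (P : Set (EuclideanSpace ℝ (Fin n))) : Prop :=
  (∃ V : Set (EuclideanSpace ℝ (Fin n)), V.Finite ∧ P = convexHull ℝ V) ∧ (interior P).Nonempty

/-- Facet of a convex set `P` in `ℝⁿ`: a nonempty exposed face (the set of all maximizers on `P`
of some linear functional) of dimension `n - 1`. -/
def IsFacet {n : ℕ} (P F : Set (EuclideanSpace ℝ (Fin n))) : Prop :=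
  IsExposed ℝ P F ∧ F.Nonempty ∧ Module.finrank ℝ (vectorSpan ℝ F) + 1 = n

/-- `(n-1)`-dimensional volume of a subset of `ℝⁿ`: the `(n-1)`-dimensional Hausdorff measure,
normalized so that it is Lebesgue measure on `(n-1)`-dimensional Euclidean space. -/
noncomputable def facetArea {n : ℕ} (F : Set (EuclideanSpace ℝ (Fin n))) : ℝ≥0∞ :=
  Measure.euclideanHausdorffMeasure (n - 1) F

/-- `P` has exactly `m` facets, which can be listed without repetition as `F 1, …, F m` so that
`F i` has area `S i`. -/
def HasFacetAreas {n : ℕ} (P : Set (EuclideanSpace ℝ (Fin n))) (m : ℕ) (S : ℕ → ℝ) : Prop :=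
  ∃ F : ℕ → Set (EuclideanSpace ℝ (Fin n)),
    Set.BijOn F (Set.Icc 1 m) {G | IsFacet P G} ∧
      ∀ i ∈ Set.Icc 1 m, facetArea (F i) = ENNReal.ofReal (S i)

/-! Any distinct, spanning unit normals u_i with ∑ S_i u_i = 0 are, by Minkowski's theorem, the
facet normals of a polytope with areas S_i. The freedom in choosing the normals is what makes the
volume small.

The variational proof of Minkowski's theorem makes this quantitative. Let V(b) be the volume of {x |
⟪u_i, x⟫ ≤ b_i}. Since ∂V/∂b_i is the area of the i-th face (`hasDerivAt_volume_polyhedron`), a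
maximiser of V on ∑ S_i b_i = 1 has areas n V S_i (`exists_polyhedron_area_eq`). Scaling by c with
c^(n-1) = 1/(nV) gives areas S_i and volume c^n V = c/n, so it suffices that the maximum V be large.
By homogeneity V(1,…,1) ≤ V (∑ S_i)^n, and V(1,…,1) is large once all normals are nearly orthogonal
to a unit vector e: the body then contains many disjoint balls strung along e
(`mul_volume_ball_le_volume_polyhedron`).

Such normals are built in ℂ × ℝ^(n-2) (`exists_unit_normals`). The second components are small and
balanced, and vanish for two of the indices, one of them that of the largest area. The first
components, weighted by the areas, close up to a planar polygon: the strict inequality on the areas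
survives a slight shortening of the other sides. -/

/-- The intersection of the half-spaces `⟪u i, x⟫ ≤ b i`. -/
def polyhedron {ι E : Type*} [NormedAddCommGroup E] [InnerProductSpace ℝ E]
    (u : ι → E) (b : ι → ℝ) : Set E := {x | ∀ i, inner ℝ (u i) x ≤ b i}

/-- The face of `polyhedron u b` cut out by equality in the `i`-th inequality. -/
def polyhedronFace {ι E : Type*} [NormedAddCommGroup E] [InnerProductSpace ℝ E]
    (u : ι → E) (b : ι → ℝ) (i : ι) : Set E := polyhedron u b ∩ {x | inner ℝ (u i) x = b i}

/-! ### Polyhedra: scaling, boundedness, continuity of volume -/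

section Polyhedron

open Set Filter Topology
open scoped Pointwise

variable {ι E : Type*} [NormedAddCommGroup E] [InnerProductSpace ℝ E]

theorem isClosed_polyhedron (u : ι → E) (b : ι → ℝ) : IsClosed (polyhedron u b) := by
  simp only [polyhedron, ofPred_forall]
  exact isClosed_iInter fun i => isClosed_le (by fun_prop) (by fun_prop)

theorem convex_polyhedron (u : ι → E) (b : ι → ℝ) : Convex ℝ (polyhedron u b) := by
  simp only [polyhedron, ofPred_forall]
  exact convex_iInter fun i => convex_halfSpace_le (innerₛₗ ℝ (u i)).isLinear _

theorem polyhedron_mono (u : ι → E) {b c : ι → ℝ} (h : b ≤ c) :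
    polyhedron u b ⊆ polyhedron u c := fun _ hx i => (hx i).trans (h i)

theorem polyhedron_smul (u : ι → E) (b : ι → ℝ) {c : ℝ} (hc : 0 < c) :
    polyhedron u (c • b) = c • polyhedron u b := by
  ext x
  rw [mem_smul_set_iff_inv_smul_mem₀ hc.ne']
  simp only [polyhedron, mem_ofPred_eq, inner_smul_right, Pi.smul_apply, smul_eq_mul]
  exact forall_congr' fun i => by rw [inv_mul_le_iff₀ hc]

theorem polyhedronFace_smul (u : ι → E) (b : ι → ℝ) (i : ι) {c : ℝ} (hc : 0 < c) :
    polyhedronFace u (c • b) i = c • polyhedronFace u b i := by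
  rw [polyhedronFace, polyhedron_smul u b hc, polyhedronFace, smul_set_inter₀ hc.ne']
  congr 1
  ext x
  rw [mem_smul_set_iff_inv_smul_mem₀ hc.ne']
  simp only [mem_ofPred_eq, inner_smul_right, Pi.smul_apply, smul_eq_mul]
  rw [inv_mul_eq_iff_eq_mul₀ hc.ne']

/-- The balance relation turns the upper bounds on the other ⟪u j, x⟫ into a lower bound on ⟪u i,
x⟫; spanning makes x ↦ (⟪u i, x⟫)ᵢ injective, hence antilipschitz. -/
theorem isBounded_polyhedron [Fintype ι] [FiniteDimensional ℝ E] {u : ι → E} {S : ι → ℝ}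
    (hS : ∀ i, 0 < S i) (hsum : ∑ i, S i • u i = 0) (hspan : Submodule.span ℝ (range u) = ⊤)
    (b : ι → ℝ) : Bornology.IsBounded (polyhedron u b) := by
  classical
  let T : E →ₗ[ℝ] (ι → ℝ) := LinearMap.pi fun i => innerₛₗ ℝ (u i)
  have hT : LinearMap.ker T = ⊥ := by
    rw [LinearMap.ker_eq_bot']
    intro x hx
    have h0 : ∀ i, inner ℝ (u i) x = 0 := fun i => congr_fun hx i
    have : x ∈ (Submodule.span ℝ (range u))ᗮ := by
      rw [Submodule.mem_orthogonal]
      intro y hy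
      induction hy using Submodule.span_induction with
      | mem y hy => obtain ⟨i, rfl⟩ := hy; exact h0 i
      | zero => simp
      | add y z _ _ h1 h2 => rw [inner_add_left, h1, h2, add_zero]
      | smul c y _ h1 => rw [real_inner_smul_left, h1, mul_zero]
    simpa [hspan] using this
  obtain ⟨K, -, hK⟩ := T.exists_antilipschitzWith hT
  refine (hK.isBounded_preimage (s := Icc (fun i => -(∑ j, S j * |b j|) / S i) b)
    (Metric.isBounded_Icc _ _)).subset fun x hx => ?_
  refine ⟨fun i => ?_, fun i => hx i⟩
  have h0 : ∑ j, S j * inner ℝ (u j) x = 0 := by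
    have := congrArg (fun y => inner ℝ y x) hsum
    simpa [sum_inner, real_inner_smul_left] using this
  rw [← Finset.add_sum_erase _ _ (Finset.mem_univ i)] at h0
  have h1 : ∑ j ∈ Finset.univ.erase i, S j * inner ℝ (u j) x ≤ ∑ j, S j * |b j| := by
    refine (Finset.sum_le_sum fun j _ => ?_).trans
      (Finset.sum_le_sum_of_subset_of_nonneg (Finset.erase_subset i Finset.univ)
        fun j _ _ => mul_nonneg (hS j).le (abs_nonneg _))
    exact mul_le_mul_of_nonneg_left ((hx j).trans (le_abs_self _)) (hS j).le
  change -(∑ j, S j * |b j|) / S i ≤ inner ℝ (u i) x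
  rw [div_le_iff₀ (hS i)]
  linarith [mul_comm (S i) (inner ℝ (u i) x)]

theorem isBounded_section {u : ι → E} (hbdd : ∀ b, Bornology.IsBounded (polyhedron u b)) (i : ι)
    (b : ι → ℝ) :
    Bornology.IsBounded
      (polyhedron (fun j => (ℝ ∙ u i)ᗮ.orthogonalProjectionOnto (u j)) b) := by
  refine ((isometry_subtype_coe (s := ((ℝ ∙ u i)ᗮ : Set E))).antilipschitz.isBounded_preimage
    (hbdd b)).subset fun y hy j => ?_
  simpa using hy j

variable [MeasurableSpace E] [BorelSpace E]

theorem area_polyhedronFace_smul (u : ι → E) (b : ι → ℝ) (i : ι) (d : ℕ) {c : ℝ} (hc : 0 < c) :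
    Measure.euclideanHausdorffMeasure d (polyhedronFace u (c • b) i) =
      ENNReal.ofReal (c ^ d) * Measure.euclideanHausdorffMeasure d (polyhedronFace u b i) := by
  rw [polyhedronFace_smul u b i hc, Measure.euclideanHausdorffMeasure_smul₀ d hc.ne',
    ENNReal.smul_def, smul_eq_mul]
  congr 1
  rw [ENNReal.ofReal, Real.toNNReal_pow hc.le]
  congr 2
  ext
  simp [hc.le]

variable [FiniteDimensional ℝ E]

theorem volume_inner_eq_const {v : E} {c : ℝ} (h : v ≠ 0 ∨ c ≠ 0) :
    volume {x : E | inner ℝ v x = c} = 0 := by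
  rcases eq_empty_or_nonempty {x : E | inner ℝ v x = c} with h0 | ⟨x₀, hx₀⟩
  · simp [h0]
  · have hv : v ≠ 0 := by
      rintro rfl
      simp only [inner_zero_left, mem_ofPred_eq] at hx₀
      simp [hx₀.symm] at h
    have hker : LinearMap.ker (innerₛₗ ℝ v) ≠ ⊤ := by
      intro h
      have : v ∈ LinearMap.ker (innerₛₗ ℝ v) := by rw [h]; trivial
      simp [hv] at this
    have h1 := Measure.addHaar_submodule (volume : Measure E) _ hker
    rw [← measure_preimage_add_right volume (-x₀)] at h1
    refine measure_mono_null (fun x hx => ?_) h1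
    simp only [mem_ofPred_eq] at hx hx₀
    simp [inner_add_right, hx, hx₀]

/-- Off the null boundary hyperplanes, membership is locally constant in the bounds. Zero normals
are admitted because projected normals may vanish. -/
theorem continuousAt_volume_polyhedron [Finite ι] {u : ι → E}
    (hbdd : ∀ b, Bornology.IsBounded (polyhedron u b)) {b : ι → ℝ} (hb : ∀ i, u i ≠ 0 ∨ b i ≠ 0) :
    ContinuousAt (fun c => volume (polyhedron u c)) b := by
  have := Fintype.ofFinite ι
  have hle : ∀ᶠ c in 𝓝 b, c ≤ b + 1 := by
    have : ∀ᶠ c in 𝓝 b, ∀ i, c i < b i + 1 := by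
      rw [eventually_all]
      intro i
      exact (continuous_apply i).continuousAt.eventually (gt_mem_nhds (by simp))
    exact this.mono fun c hc i => (hc i).le
  refine tendsto_measure_of_ae_tendsto_indicator (𝓝 b) (isClosed_polyhedron u b).measurableSet
    (fun c => (isClosed_polyhedron u c).measurableSet)
    (isClosed_polyhedron u (b + 1)).measurableSet (hbdd (b + 1)).measure_lt_top.ne
    (hle.mono fun c hc => polyhedron_mono u hc) ?_
  have hae : ∀ᵐ x : E, ∀ i, inner ℝ (u i) x ≠ b i := by
    rw [ae_all_iff]
    intro i
    rw [ae_iff]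
    simpa using volume_inner_eq_const (hb i)
  filter_upwards [hae] with x hx
  have : ∀ᶠ c in 𝓝 b, ∀ i, (inner ℝ (u i) x ≤ c i ↔ inner ℝ (u i) x ≤ b i) := by
    rw [eventually_all]
    intro i
    have hc : Tendsto (fun c : ι → ℝ => c i) (𝓝 b) (𝓝 (b i)) := (continuous_apply i).continuousAt
    rcases (hx i).lt_or_gt with h | h
    · exact (hc.eventually (lt_mem_nhds h)).mono fun c hc => by simp [hc.le, h.le]
    · exact (hc.eventually (gt_mem_nhds h)).mono fun c hc => by simp [hc.not_ge, h.not_ge]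
  exact this.mono fun c hc => forall_congr' hc

theorem volume_polyhedron_smul (u : ι → E) (b : ι → ℝ) {c : ℝ} (hc : 0 < c) :
    volume (polyhedron u (c • b)) =
      ENNReal.ofReal (c ^ Module.finrank ℝ E) * volume (polyhedron u b) := by
  rw [polyhedron_smul u b hc, Measure.addHaar_smul_of_nonneg _ hc.le]

theorem volume_polyhedron_sub_inner (u : ι → E) (b : ι → ℝ) (x : E) :
    volume (polyhedron u fun i => b i - inner ℝ (u i) x) = volume (polyhedron u b) := by
  rw [← measure_preimage_add_right volume x (polyhedron u b)]
  congr 1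
  ext y
  simp [polyhedron, inner_add_right, le_sub_iff_add_le]

end Polyhedron

/-! ### Facet area as a partial derivative of volume -/

section FacetDerivative

open Set Filter Topology Module
open scoped Pointwise RealInnerProductSpace

variable {ι E : Type*} [DecidableEq ι] [NormedAddCommGroup E] [InnerProductSpace ℝ E]
  [FiniteDimensional ℝ E] [MeasurableSpace E] [BorelSpace E]

/-- Right-hand sides of the inequalities describing a section orthogonal to `u i`, in terms of
the orthogonal projections of the normals. -/
noncomputable def sectionBound (u : ι → E) (b : ι → ℝ) (i : ι) (s : ℝ) : ι → ℝ :=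
  -- The projection of `u i` is 0, so the value 1 makes this constraint vacuous, and it is nonzero
  -- as continuity of the volume requires.
  fun j => if j = i then 1 else b j - s * inner ℝ (u j) (u i)

omit [FiniteDimensional ℝ E] [MeasurableSpace E] [BorelSpace E] in
theorem polyhedronFace_update_eq_image {u : ι → E} {i : ι} (hu : ‖u i‖ = 1) (b : ι → ℝ) (s : ℝ) :
    polyhedronFace u (Function.update b i s) i =
      (fun y : (ℝ ∙ u i)ᗮ => s • u i + (y : E)) ''
        polyhedron (fun j => (ℝ ∙ u i)ᗮ.orthogonalProjectionOnto (u j)) (sectionBound u b i s) := by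
  have horth : ∀ y : (ℝ ∙ u i)ᗮ, inner ℝ (u i) (y : E) = 0 := fun y =>
    Submodule.mem_orthogonal_singleton_iff_inner_right.1 y.2
  have hii : inner ℝ (u i) (u i) = (1 : ℝ) := by rw [real_inner_self_eq_norm_sq, hu, one_pow]
  have hproj : ∀ j (y : (ℝ ∙ u i)ᗮ),
      inner ℝ ((ℝ ∙ u i)ᗮ.orthogonalProjectionOnto (u j)) y = inner ℝ (u j) (y : E) := fun j y => by
    simp
  ext x
  simp only [polyhedronFace, polyhedron, mem_inter_iff, mem_ofPred_eq, mem_image,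
    Function.update_self, hproj]
  constructor
  · rintro ⟨hx, hxi⟩
    have hy : x - s • u i ∈ (ℝ ∙ u i)ᗮ := by
      rw [Submodule.mem_orthogonal_singleton_iff_inner_right, inner_sub_right, inner_smul_right, hii,
        hxi, mul_one, sub_self]
    refine ⟨⟨x - s • u i, hy⟩, fun j => ?_, by simp⟩
    rcases eq_or_ne j i with rfl | hj
    · rw [horth]
      simp [sectionBound]
    · have := hx j
      rw [Function.update_of_ne hj] at this
      simpa [sectionBound, hj, inner_sub_right, inner_smul_right] using this
  · rintro ⟨y, hy, rfl⟩
    have hyi : inner ℝ (u i) (s • u i + (y : E)) = s := by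
      rw [inner_add_right, inner_smul_right, hii, horth, mul_one, add_zero]
    refine ⟨fun j => ?_, hyi⟩
    rcases eq_or_ne j i with rfl | hj
    · simp [hyi]
    · have := hy j
      rw [Function.update_of_ne hj, inner_add_right, inner_smul_right]
      simp only [sectionBound, hj, if_false] at this
      linarith

omit [DecidableEq ι] [MeasurableSpace E] [BorelSpace E] in
theorem finrank_orthogonal_span_singleton_add_one {v : E} (hv : v ≠ 0) :
    finrank ℝ (ℝ ∙ v)ᗮ + 1 = finrank ℝ E := by
  have h1 := finrank_span_singleton (K := ℝ) hv
  have := (ℝ ∙ v).finrank_add_finrank_orthogonal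
  omega

theorem area_polyhedronFace_update {u : ι → E} {i : ι} (hu : ‖u i‖ = 1) (b : ι → ℝ) (s : ℝ) :
    Measure.euclideanHausdorffMeasure (finrank ℝ E - 1)
      (polyhedronFace u (Function.update b i s) i) =
    volume (polyhedron (fun j => (ℝ ∙ u i)ᗮ.orthogonalProjectionOnto (u j))
      (sectionBound u b i s)) := by
  have hrank : finrank ℝ (ℝ ∙ u i)ᗮ = finrank ℝ E - 1 :=
    Nat.eq_sub_of_add_eq (finrank_orthogonal_span_singleton_add_one
      (by rintro h; simp [h] at hu))
  have hiso : Isometry (fun y : (ℝ ∙ u i)ᗮ => s • u i + (y : E)) :=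
    (isometry_add_left (s • u i)).comp isometry_subtype_coe
  rw [← InnerProductSpace.euclideanHausdorffMeasure_eq_volume, hrank,
    ← hiso.euclideanHausdorffMeasure_image, polyhedronFace_update_eq_image hu]

/-- A set of positive measure in the hyperplane lies in no proper affine subspace of it. -/
theorem vectorSpan_polyhedronFace {u : ι → E} {i : ι} (hu : ‖u i‖ = 1) {b : ι → ℝ}
    (hA : Measure.euclideanHausdorffMeasure (finrank ℝ E - 1) (polyhedronFace u b i) ≠ 0) :
    vectorSpan ℝ (polyhedronFace u b i) = (ℝ ∙ u i)ᗮ := by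
  rw [← Function.update_eq_self i b, area_polyhedronFace_update hu] at hA
  have htop : affineSpan ℝ (polyhedron (fun j => (ℝ ∙ u i)ᗮ.orthogonalProjectionOnto (u j))
      (sectionBound u b i (b i))) = ⊤ := by
    by_contra h
    exact hA (measure_mono_null (subset_affineSpan ℝ _) (Measure.addHaar_affineSubspace _ _ h))
  have himage := polyhedronFace_update_eq_image hu b (b i)
  rw [Function.update_eq_self] at himage
  let f : (ℝ ∙ u i)ᗮ →ᵃ[ℝ] E :=
    (AffineEquiv.constVAdd ℝ E (b i • u i)).toAffineMap.comp (ℝ ∙ u i)ᗮ.subtype.toAffineMap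
  have hf : polyhedronFace u b i = f '' polyhedron (fun j =>
      (ℝ ∙ u i)ᗮ.orthogonalProjectionOnto (u j)) (sectionBound u b i (b i)) := himage
  rw [hf, ← AffineMap.map_vectorSpan, ← direction_affineSpan, htop,
    AffineSubspace.direction_top]
  have hlin : f.linear = (ℝ ∙ u i)ᗮ.subtype := by ext; simp [f]
  rw [hlin, Submodule.map_top, Submodule.range_subtype]

theorem continuousOn_area_polyhedronFace [Finite ι] {u : ι → E} (hu : ∀ i, ‖u i‖ = 1)
    (hinj : Function.Injective u) (hbdd : ∀ b, Bornology.IsBounded (polyhedron u b)) {b : ι → ℝ}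
    (hb : ∀ i, 0 < b i) (i : ι) :
    ContinuousOn (fun s => Measure.euclideanHausdorffMeasure (finrank ℝ E - 1)
      (polyhedronFace u (Function.update b i s) i)) (Ioi 0) := by
  simp only [area_polyhedronFace_update (hu i)]
  intro s hs
  refine ContinuousAt.continuousWithinAt ?_
  have hc : ContinuousAt (sectionBound u b i) s := by
    rw [continuousAt_pi]
    intro j
    unfold sectionBound
    by_cases hj : j = i <;> simp only [hj, if_true, if_false] <;> fun_prop
  refine ContinuousAt.comp (f := sectionBound u b i)
    (continuousAt_volume_polyhedron (isBounded_section hbdd i) fun j => ?_) hc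
  unfold sectionBound
  split_ifs with hj
  · simp
  -- A projected normal vanishes only if `u j = ±u i`. Injectivity excludes the plus sign; for the
  -- minus sign the bound is `b j + s > 0`.
  · by_contra! h
    obtain ⟨h0, h1⟩ := h
    rw [Submodule.orthogonalProjectionOnto_eq_zero_iff, Submodule.orthogonal_orthogonal,
      Submodule.mem_span_singleton] at h0
    obtain ⟨a, ha⟩ := h0
    have ha1 : |a| = 1 := by
      have := congrArg norm ha
      simpa [norm_smul, hu] using this
    rcases (abs_eq zero_le_one).1 ha1 with rfl | rfl
    · exact hj (hinj (by rw [← ha, one_smul]))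
    · rw [← ha] at h1
      simp [hu] at h1
      linarith [hb j, mem_Ioi.1 hs]

/-- Cavalieri: the slice at height `s ≤ t` is the face obtained by lowering the `i`-th bound to `s`,
and does not depend on `t`. -/
theorem volume_polyhedron_eq_lintegral {u : ι → E} {i : ι} (hu : ‖u i‖ = 1) (b : ι → ℝ) (t : ℝ) :
    volume (polyhedron u (Function.update b i t)) =
      ∫⁻ s in Iic t, Measure.euclideanHausdorffMeasure (finrank ℝ E - 1)
        (polyhedronFace u (Function.update b i s) i) := by
  have hne : u i ≠ 0 := by rintro h; simp [h] at hu
  rw [← InnerProductSpace.euclideanHausdorffMeasure_eq_volume,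
    EuclideanGeometry.euclideanHausdorffMeasure_eq_lintegral (0 : E) hne
      (isClosed_polyhedron _ _).measurableSet, ← ofReal_norm, hu, ENNReal.ofReal_one, one_mul,
    ← lintegral_indicator measurableSet_Iic]
  congr 1
  ext s
  have hmem : ∀ x : E, x ∈ AffineSubspace.mk' (s • u i +ᵥ (0 : E)) (ℝ ∙ u i)ᗮ ↔
      inner ℝ (u i) x = s := fun x => by
    rw [AffineSubspace.mem_mk', Submodule.mem_orthogonal_singleton_iff_inner_right]
    simp [inner_sub_right, inner_smul_right, hu, sub_eq_zero]
  by_cases hs : s ≤ t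
  · rw [indicator_of_mem (mem_Iic.2 hs)]
    congr 1
    ext x
    simp only [polyhedronFace, polyhedron, mem_inter_iff, SetLike.mem_coe, hmem, mem_ofPred_eq,
      Function.update_self]
    refine and_congr_left fun hx => forall_congr' fun j => ?_
    rcases eq_or_ne j i with rfl | hj
    · simp [hx, hs]
    · simp [Function.update_of_ne hj]
  · rw [indicator_of_notMem (by simpa using hs)]
    convert measure_empty (μ := Measure.euclideanHausdorffMeasure (X := E) (finrank ℝ E - 1))
    rw [eq_empty_iff_forall_notMem]
    rintro x ⟨hx, hx'⟩
    have := hx i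
    rw [(hmem x).1 hx', Function.update_self] at this
    exact hs this

theorem area_polyhedronFace_ne_top {u : ι → E} {i : ι} (hu : ‖u i‖ = 1)
    (hbdd : ∀ b, Bornology.IsBounded (polyhedron u b)) (b : ι → ℝ) :
    Measure.euclideanHausdorffMeasure (finrank ℝ E - 1) (polyhedronFace u b i) ≠ ∞ := by
  rw [← Function.update_eq_self i b, area_polyhedronFace_update hu]
  exact (isBounded_section hbdd i _).measure_lt_top.ne

theorem hasDerivAt_volume_polyhedron [Finite ι] {u : ι → E} (hu : ∀ i, ‖u i‖ = 1)
    (hinj : Function.Injective u) (hbdd : ∀ b, Bornology.IsBounded (polyhedron u b)) {b : ι → ℝ}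
    (hb : ∀ i, 0 < b i) (i : ι) :
    HasDerivAt (fun t => (volume (polyhedron u (Function.update b i t))).toReal)
      (Measure.euclideanHausdorffMeasure (finrank ℝ E - 1) (polyhedronFace u b i)).toReal (b i) := by
  set a : ℝ → ℝ≥0∞ := fun s => Measure.euclideanHausdorffMeasure (finrank ℝ E - 1)
    (polyhedronFace u (Function.update b i s) i) with ha
  have hfin : ∀ s, a s ≠ ∞ := fun s => area_polyhedronFace_ne_top (hu i) hbdd _
  have hcont : ContinuousOn (fun s => (a s).toReal) (Ioi 0) := fun s hs =>
    (ENNReal.tendsto_toReal (hfin s)).comp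
      (continuousOn_area_polyhedronFace hu hinj hbdd hb i s hs)
  have hV : ∀ t, volume (polyhedron u (Function.update b i t)) = ∫⁻ s in Iic t, a s :=
    volume_polyhedron_eq_lintegral (hu i) b
  have hVfin : ∀ t, ∫⁻ s in Iic t, a s ≠ ∞ := fun t => by
    rw [← hV]
    exact (hbdd _).measure_lt_top.ne
  have hIoc : ∀ {s t}, 0 < s → s ≤ t →
      (∫⁻ x in Iic t, a x).toReal - (∫⁻ x in Iic s, a x).toReal = ∫ x in s..t, (a x).toReal := by
    intro s t hs hst
    have hsub : Icc s t ⊆ Ioi 0 := fun x hx => hs.trans_le hx.1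
    have hm : AEStronglyMeasurable (fun x => (a x).toReal) (volume.restrict (Ioc s t)) :=
      (hcont.mono (Ioc_subset_Icc_self.trans hsub)).aestronglyMeasurable measurableSet_Ioc
    rw [intervalIntegral.integral_of_le hst,
      integral_eq_lintegral_of_nonneg_ae (Eventually.of_forall fun _ => ENNReal.toReal_nonneg) hm]
    have : ∫⁻ x in Iic t, a x = (∫⁻ x in Iic s, a x) + ∫⁻ x in Ioc s t, a x := by
      rw [← lintegral_union measurableSet_Ioc
        (by rw [Set.disjoint_left]; intro x hx hx'; exact absurd hx'.1 (not_lt.2 hx)),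
        Iic_union_Ioc_eq_Iic hst]
    have hfin2 : ∫⁻ x in Ioc s t, a x ≠ ∞ := by
      intro h
      rw [h, add_top] at this
      exact hVfin t this
    rw [this, ENNReal.toReal_add (hVfin s) hfin2, add_sub_cancel_left]
    simp [ENNReal.ofReal_toReal (hfin _)]
  have hFTC : HasDerivAt (fun t => ∫ x in (b i)..t, (a x).toReal) (a (b i)).toReal (b i) := by
    refine intervalIntegral.integral_hasDerivAt_right (by simp)
      (ContinuousAt.stronglyMeasurableAtFilter isOpen_Ioi
        (fun x hx => hcont.continuousAt (isOpen_Ioi.mem_nhds hx)) _ (hb i))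
      (hcont.continuousAt (isOpen_Ioi.mem_nhds (hb i)))
  have hval : a (b i) = Measure.euclideanHausdorffMeasure (finrank ℝ E - 1)
      (polyhedronFace u b i) := by simp [ha]
  rw [← hval]
  refine (hFTC.add_const (volume (polyhedron u b)).toReal).congr_of_eventuallyEq ?_
  filter_upwards [isOpen_Ioi.mem_nhds (hb i)] with t ht
  have hb0 : volume (polyhedron u b) = ∫⁻ s in Iic (b i), a s := by
    rw [← hV, Function.update_eq_self]
  rw [hV, hb0]
  rcases le_total (b i) t with h | h
  · linarith [hIoc (hb i) h]
  · rw [intervalIntegral.integral_symm]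
    linarith [hIoc ht h]

end FacetDerivative

/-! ### Minkowski's existence theorem by maximising volume -/

section Minkowski

open Set Filter Topology Module

variable {ι E : Type*} [Fintype ι] [NormedAddCommGroup E] [InnerProductSpace ℝ E]
  [FiniteDimensional ℝ E] [MeasurableSpace E] [BorelSpace E]

theorem volume_polyhedron_pos (u : ι → E) {b : ι → ℝ} (hb : ∀ i, 0 < b i) :
    0 < volume (polyhedron u b) := by
  have hnhds : polyhedron u b ∈ 𝓝 (0 : E) := by
    have : ∀ᶠ x in 𝓝 (0 : E), ∀ i, inner ℝ (u i) x < b i := by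
      rw [eventually_all]
      intro i
      have : ContinuousAt (fun x : E => inner ℝ (u i) x) 0 := by fun_prop
      exact this.eventually (gt_mem_nhds (by simpa using hb i))
    exact this.mono fun x hx i => (hx i).le
  exact Measure.measure_pos_of_mem_nhds _ hnhds

theorem exists_forall_inner_lt {u : ι → E} (hu : ∀ i, u i ≠ 0) {b : ι → ℝ}
    (hV : volume (polyhedron u b) ≠ 0) : ∃ x, ∀ i, inner ℝ (u i) x < b i := by
  have hae : ∀ᵐ x : E, ∀ i, inner ℝ (u i) x ≠ b i := by
    rw [ae_all_iff]
    intro i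
    rw [ae_iff]
    simpa using volume_inner_eq_const (Or.inl (hu i))
  by_contra! h
  refine hV (measure_mono_null (fun x hx => ?_) (ae_iff.1 hae))
  obtain ⟨i, hi⟩ := h x
  exact fun hx' => hx' i ((hx i).antisymm hi)

/-- The variational form of Minkowski's theorem: among polytopes with facet normals `u` the one of
greatest volume for a given value of `∑ i, S i * b i` has facet areas proportional to `S`. -/
theorem exists_polyhedron_area_eq [Nonempty ι] {u : ι → E} {S : ι → ℝ} (hu : ∀ i, ‖u i‖ = 1)
    (hinj : Function.Injective u) (hS : ∀ i, 0 < S i) (hsum : ∑ i, S i • u i = 0)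
    (hspan : Submodule.span ℝ (range u) = ⊤) :
    ∃ b : ι → ℝ, (∀ i, 0 < b i) ∧
      (∀ i, (Measure.euclideanHausdorffMeasure (finrank ℝ E - 1) (polyhedronFace u b i)).toReal =
        finrank ℝ E * (volume (polyhedron u b)).toReal * S i) ∧
      ∀ c : ι → ℝ, (∀ i, 0 < c i) → (volume (polyhedron u c)).toReal ≤
        (volume (polyhedron u b)).toReal * (∑ i, S i * c i) ^ finrank ℝ E := by
  classical
  have hbdd := isBounded_polyhedron hS hsum hspan
  have hne : ∀ i, u i ≠ 0 := fun i h => by simpa [h] using hu i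
  set V : (ι → ℝ) → ℝ := fun c => (volume (polyhedron u c)).toReal with hVdef
  have hVcont : Continuous V := continuous_iff_continuousAt.2 fun c =>
    (ENNReal.tendsto_toReal (hbdd c).measure_lt_top.ne).comp
      (continuousAt_volume_polyhedron hbdd fun i => Or.inl (hne i))
  have hVpos : ∀ c : ι → ℝ, (∀ i, 0 < c i) → 0 < V c := fun c hc =>
    ENNReal.toReal_pos (volume_polyhedron_pos u hc).ne' (hbdd c).measure_lt_top.ne
  set Δ : Set (ι → ℝ) := {c | (∀ i, 0 ≤ c i) ∧ ∑ i, S i * c i = 1} with hΔ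
  have hcompact : IsCompact Δ := by
    refine (isCompact_Icc (a := (0 : ι → ℝ)) (b := fun i => (S i)⁻¹)).of_isClosed_subset ?_ ?_
    · refine IsClosed.inter ?_ (isClosed_eq (by fun_prop) (by fun_prop))
      exact isClosed_Ici (a := (0 : ι → ℝ))
    · rintro c ⟨hc, hc1⟩
      refine ⟨hc, fun i => ?_⟩
      change c i ≤ (S i)⁻¹
      rw [← one_div, le_div_iff₀ (hS i), mul_comm, ← hc1]
      exact Finset.single_le_sum (f := fun i => S i * c i)
        (fun j _ => mul_nonneg (hS j).le (hc j)) (Finset.mem_univ i)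
  have hSsum : 0 < ∑ i, S i := Finset.sum_pos (fun i _ => hS i) Finset.univ_nonempty
  have hmem : (fun _ => (∑ i, S i)⁻¹ : ι → ℝ) ∈ Δ :=
    ⟨fun _ => (inv_pos.2 hSsum).le, by rw [← Finset.sum_mul, mul_inv_cancel₀ hSsum.ne']⟩
  obtain ⟨b₀, hb₀, hmax⟩ := hcompact.exists_isMaxOn ⟨_, hmem⟩ hVcont.continuousOn
  have hV₀ : 0 < V b₀ := (hVpos _ fun _ => inv_pos.2 hSsum).trans_le (hmax hmem)
  obtain ⟨x, hx⟩ := exists_forall_inner_lt hne (ENNReal.toReal_pos_iff.1 hV₀).1.ne'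
  -- Moving the origin to an interior point makes all bounds positive; neither the volume nor, by
  -- balance, ∑ S_i b_i changes.
  set b : ι → ℝ := fun i => b₀ i - inner ℝ (u i) x with hbdef
  have hb : ∀ i, 0 < b i := fun i => sub_pos.2 (hx i)
  have hVb : V b = V b₀ := by simp only [hVdef, hbdef, volume_polyhedron_sub_inner]
  have hLb : ∑ i, S i * b i = 1 := by
    have h0 : ∑ i, S i * inner ℝ (u i) x = 0 := by
      have := congrArg (fun y => inner ℝ y x) hsum
      simpa [sum_inner, real_inner_smul_left] using this
    simp only [hbdef, mul_sub, Finset.sum_sub_distrib, h0, hb₀.2, sub_zero]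
  have hle : ∀ c : ι → ℝ, (∀ i, 0 < c i) → V c ≤ V b * (∑ i, S i * c i) ^ finrank ℝ E := by
    intro c hc
    set ℓ := ∑ i, S i * c i with hℓ
    have hℓpos : 0 < ℓ := Finset.sum_pos (fun i _ => mul_pos (hS i) (hc i)) Finset.univ_nonempty
    have hcΔ : ℓ⁻¹ • c ∈ Δ := by
      refine ⟨fun i => (mul_pos (inv_pos.2 hℓpos) (hc i)).le, ?_⟩
      simp only [Pi.smul_apply, smul_eq_mul, mul_left_comm (S _)]
      rw [← Finset.mul_sum]
      exact inv_mul_cancel₀ hℓpos.ne'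
    have h1 : V c = ℓ ^ finrank ℝ E * V (ℓ⁻¹ • c) := by
      have := volume_polyhedron_smul u (ℓ⁻¹ • c) hℓpos
      rw [smul_inv_smul₀ hℓpos.ne'] at this
      simp only [hVdef, this, ENNReal.toReal_mul]
      rw [ENNReal.toReal_ofReal (by positivity)]
    rw [h1, mul_comm, hVb]
    exact mul_le_mul_of_nonneg_right (hmax hcΔ) (by positivity)
  refine ⟨b, hb, fun i => ?_, hle⟩
  have hL : ∀ t, ∑ j, S j * Function.update b i t j = 1 + S i * (t - b i) := fun t => by
    rw [← hLb, ← Finset.add_sum_erase _ _ (Finset.mem_univ i),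
      ← Finset.add_sum_erase _ (fun j => S j * b j) (Finset.mem_univ i), Function.update_self,
      Finset.sum_congr rfl fun j hj => by rw [Function.update_of_ne (Finset.ne_of_mem_erase hj)]]
    ring
  have hder : HasDerivAt (fun t => V b * (1 + S i * (t - b i)) ^ finrank ℝ E -
      V (Function.update b i t)) (V b * (finrank ℝ E * S i) -
      (Measure.euclideanHausdorffMeasure (finrank ℝ E - 1) (polyhedronFace u b i)).toReal)
      (b i) := by
    have h1 : HasDerivAt (fun t => 1 + S i * (t - b i)) (S i) (b i) := by
      simpa using (((hasDerivAt_id (b i)).sub_const (b i)).const_mul (S i)).const_add 1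
    have h2 := (h1.pow (finrank ℝ E)).const_mul (V b)
    simp only [sub_self, mul_zero, add_zero, one_pow, mul_one] at h2
    exact h2.sub (hasDerivAt_volume_polyhedron hu hinj hbdd hb i)
  -- By `hle` the difference is nonnegative, and it vanishes at `b i`; its zero derivative there is
  -- the area formula.
  have hmin : IsLocalMin (fun t => V b * (1 + S i * (t - b i)) ^ finrank ℝ E -
      V (Function.update b i t)) (b i) := by
    filter_upwards [isOpen_Ioi.mem_nhds (hb i)] with t ht
    have hpos : ∀ j, 0 < Function.update b i t j := fun j => by
      rcases eq_or_ne j i with rfl | hj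
      · simpa using ht
      · simpa [Function.update_of_ne hj] using hb j
    have := hle _ hpos
    rw [hL] at this
    simpa using this
  have := hmin.hasDerivAt_eq_zero hder
  linarith

end Minkowski

/-! ### Bounded polyhedra as polytopes, and their exposed faces -/

section Polytope

open Set Filter Topology Module

variable {ι E : Type*} [Finite ι] [NormedAddCommGroup E] [InnerProductSpace ℝ E]

/-- An extreme point is determined by its active constraints: if `x` and `y` share them, `x ± t (x -
y)` is feasible for small `t`. -/
theorem finite_extremePoints_polyhedron (u : ι → E) (b : ι → ℝ) :
    ((polyhedron u b).extremePoints ℝ).Finite := by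
  refine Set.Finite.of_injOn (f := fun x => {i | inner ℝ (u i) x = b i}) (mapsTo_univ _ _) ?_
    (toFinite univ)
  intro x hx y hy hxy
  by_contra hne
  have hiff : ∀ i, inner ℝ (u i) x = b i ↔ inner ℝ (u i) y = b i := fun i =>
    Set.ext_iff.1 hxy i
  have hclose : ∀ᶠ t : ℝ in 𝓝 0, ∀ i, inner ℝ (u i) (x + t • (x - y)) ≤ b i := by
    rw [eventually_all]
    intro i
    rcases (hx.1 i).lt_or_eq with h | h
    · have : ContinuousAt (fun t : ℝ => inner ℝ (u i) (x + t • (x - y))) 0 := by fun_prop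
      exact (this.eventually (gt_mem_nhds (by simpa using h))).mono fun t ht => le_of_lt ht
    · refine Eventually.of_forall fun t => ?_
      rw [inner_add_right, inner_smul_right, inner_sub_right, h, (hiff i).1 h]
      simp
  obtain ⟨ε, hε, hball⟩ := Metric.eventually_nhds_iff.1 hclose
  have h1 : x + (ε / 2) • (x - y) ∈ polyhedron u b :=
    hball (by rw [dist_zero_right, Real.norm_eq_abs, abs_of_pos (by positivity)]; linarith)
  have h2 : x + (-(ε / 2)) • (x - y) ∈ polyhedron u b :=
    hball (by rw [dist_zero_right, Real.norm_eq_abs, abs_neg, abs_of_pos (by positivity)]; linarith)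
  have h3 := (mem_extremePoints.1 hx).2 _ h1 _ h2
    ⟨1 / 2, 1 / 2, by norm_num, by norm_num, by norm_num, by module⟩
  have h4 : (ε / 2) • (x - y) = 0 := by simpa using h3.1
  rw [smul_eq_zero, sub_eq_zero] at h4
  exact h4.elim (by positivity) hne

variable [FiniteDimensional ℝ E]

theorem exists_finite_polyhedron_eq_convexHull {u : ι → E} {b : ι → ℝ}
    (hbdd : Bornology.IsBounded (polyhedron u b)) :
    ∃ V : Set E, V.Finite ∧ polyhedron u b = convexHull ℝ V := by
  refine ⟨_, finite_extremePoints_polyhedron u b, ?_⟩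
  exact (closure_convexHull_extremePoints
    (Metric.isCompact_of_isClosed_isBounded (isClosed_polyhedron u b) hbdd)
    (convex_polyhedron u b)).symm.trans
    ((finite_extremePoints_polyhedron u b).isCompact_convexHull ℝ).isClosed.closure_eq

omit [FiniteDimensional ℝ E] in
theorem mem_interior_polyhedron {u : ι → E} {b : ι → ℝ} {x : E}
    (hx : ∀ i, inner ℝ (u i) x < b i) : x ∈ interior (polyhedron u b) := by
  rw [mem_interior_iff_mem_nhds]
  have : ∀ᶠ y in 𝓝 x, ∀ i, inner ℝ (u i) y < b i := by
    rw [eventually_all]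
    intro i
    have : ContinuousAt (fun y : E => inner ℝ (u i) y) x := by fun_prop
    exact this.eventually (gt_mem_nhds (hx i))
  exact this.mono fun y hy i => (hy i).le

omit [Finite ι] [FiniteDimensional ℝ E] in
theorem isExposed_polyhedronFace (u : ι → E) (b : ι → ℝ) (i : ι) :
    IsExposed ℝ (polyhedron u b) (polyhedronFace u b i) := by
  rintro ⟨x₀, hx₀, hx₀'⟩
  refine ⟨innerSL ℝ (u i), Subset.antisymm (fun x hx => ⟨hx.1, fun y hy => ?_⟩)
    fun x hx => ⟨hx.1, (hx.1 i).antisymm ?_⟩⟩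
  · have h : inner ℝ (u i) x = b i := hx.2
    simpa [h] using hy i
  · have := hx.2 x₀ hx₀
    rw [mem_ofPred_eq] at hx₀'
    simpa [hx₀'] using this

/-- A proper exposed face of a full-dimensional polyhedron lies in one of its defining faces. -/
theorem exists_subset_polyhedronFace [Nonempty ι] {u : ι → E} {b : ι → ℝ}
    (hint : (interior (polyhedron u b)).Nonempty) {F : Set E}
    (hF : IsExposed ℝ (polyhedron u b) F) (hne : F.Nonempty) (hspan : vectorSpan ℝ F ≠ ⊤) :
    ∃ i, F ⊆ polyhedronFace u b i := by
  have := Fintype.ofFinite ι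
  by_contra! h
  have h' : ∀ i, ∃ x ∈ F, inner ℝ (u i) x < b i := fun i => by
    obtain ⟨x, hx, hxi⟩ := not_subset.1 (h i)
    have hxP := hF.subset hx
    exact ⟨x, hx, (hxP i).lt_of_ne fun he => hxi ⟨hxP, he⟩⟩
  choose x hxF hx using h'
  have hcard : (0 : ℝ) < Fintype.card ι := Nat.cast_pos.2 Fintype.card_pos
  -- The average of points of `F`, one strict for each constraint, is interior; a functional maximal
  -- there is zero.
  set z := ∑ i, (Fintype.card ι : ℝ)⁻¹ • x i with hz
  have hzF : z ∈ F := (hF.convex (convex_polyhedron u b)).sum_mem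
    (fun _ _ => (inv_pos.2 hcard).le) (by simp [hcard.ne']) fun i _ => hxF i
  have hzint : z ∈ interior (polyhedron u b) := by
    refine mem_interior_polyhedron fun i => ?_
    have hb : b i = ∑ _j : ι, (Fintype.card ι : ℝ)⁻¹ * b i := by
      simp [hcard.ne']
    rw [hz, inner_sum, hb]
    refine Finset.sum_lt_sum (fun j _ => ?_) ⟨i, Finset.mem_univ i, ?_⟩
    · rw [inner_smul_right]
      exact mul_le_mul_of_nonneg_left (hF.subset (hxF j) i) (inv_pos.2 hcard).le
    · rw [inner_smul_right]
      exact mul_lt_mul_of_pos_left (hx i) (inv_pos.2 hcard)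
  obtain ⟨l, rfl⟩ := hF hne
  have hmax : IsLocalMax l z := by
    filter_upwards [mem_interior_iff_mem_nhds.1 hzint] with y hy using hzF.2 y hy
  have hl : l = 0 := by
    have := hmax.hasFDerivAt_eq_zero l.hasFDerivAt
    exact this
  refine hspan ?_
  have hPF : {x ∈ polyhedron u b | ∀ y ∈ polyhedron u b, l y ≤ l x} = polyhedron u b := by
    simp [hl]
  rw [hPF, ← direction_affineSpan,
    ((convex_polyhedron u b).interior_nonempty_iff_affineSpan_eq_top).1 hint,
    AffineSubspace.direction_top]

end Polytope

/-! ### Facets are exactly the defining faces -/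

section Facets

open Set Module

variable {ι : Type*} {n : ℕ}

theorem setOf_isFacet_polyhedron [Finite ι] [Nonempty ι] {u : ι → EuclideanSpace ℝ (Fin n)}
    {b : ι → ℝ} (hu : ∀ i, ‖u i‖ = 1) (hint : (interior (polyhedron u b)).Nonempty)
    (hA : ∀ i, facetArea (polyhedronFace u b i) ≠ 0) :
    {F | IsFacet (polyhedron u b) F} = range (polyhedronFace u b) := by
  classical
  have hrank : finrank ℝ (EuclideanSpace ℝ (Fin n)) = n := finrank_euclideanSpace_fin
  have hspan : ∀ i, vectorSpan ℝ (polyhedronFace u b i) = (ℝ ∙ u i)ᗮ := fun i =>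
    vectorSpan_polyhedronFace (hu i) (by rw [hrank]; exact hA i)
  have hcodim : ∀ i, finrank ℝ (ℝ ∙ u i)ᗮ + 1 = n := fun i => by
    rw [finrank_orthogonal_span_singleton_add_one (by intro h; simpa [h] using hu i), hrank]
  refine Subset.antisymm ?_ ?_
  · rintro F ⟨hF, hne, hdim⟩
    obtain ⟨i, hi⟩ := exists_subset_polyhedronFace hint hF hne (by
      intro h
      rw [h, finrank_top, hrank] at hdim
      omega)
    have hle : vectorSpan ℝ F ≤ (ℝ ∙ u i)ᗮ := hspan i ▸ vectorSpan_mono ℝ hi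
    have heq : vectorSpan ℝ F = (ℝ ∙ u i)ᗮ :=
      Submodule.eq_of_le_of_finrank_eq hle (by have := hcodim i; omega)
    -- The exposing functional is constant along the direction of `F`, which is that of the whole
    -- face, so every point of the face is a maximiser.
    refine ⟨i, Subset.antisymm (fun x hx => ?_) hi⟩
    obtain ⟨l, rfl⟩ := hF hne
    obtain ⟨x₀, hx₀⟩ := hne
    have hker : vectorSpan ℝ {x ∈ polyhedron u b | ∀ y ∈ polyhedron u b, l y ≤ l x} ≤
        LinearMap.ker (l : EuclideanSpace ℝ (Fin n) →ₗ[ℝ] ℝ) := by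
      rw [vectorSpan_def, Submodule.span_le]
      rintro _ ⟨y, hy, z, hz, rfl⟩
      have : l y = l z := (hz.2 y hy.1).antisymm (hy.2 z hz.1)
      simp [this]
    have hmem : x - x₀ ∈ vectorSpan ℝ (polyhedronFace u b i) :=
      vsub_mem_vectorSpan ℝ hx (hi hx₀)
    rw [hspan, ← heq] at hmem
    have hlx : l x = l x₀ := by simpa [sub_eq_zero] using hker hmem
    exact ⟨hx.1, fun y hy => hlx ▸ hx₀.2 y hy⟩
  · rintro _ ⟨i, rfl⟩
    refine ⟨isExposed_polyhedronFace u b i, ?_, by rw [hspan, hcodim]⟩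
    rw [nonempty_iff_ne_empty]
    intro h
    exact hA i (by rw [h, facetArea, measure_empty])

/-- Equal faces have parallel normals; opposite normals would force `b i = -b j`, against
positivity. -/
theorem injective_polyhedronFace {u : ι → EuclideanSpace ℝ (Fin n)} {b : ι → ℝ}
    (hu : ∀ i, ‖u i‖ = 1) (hinj : Function.Injective u) (hb : ∀ i, 0 < b i)
    (hA : ∀ i, facetArea (polyhedronFace u b i) ≠ 0) :
    Function.Injective (polyhedronFace u b) := by
  classical
  have hspan : ∀ i, vectorSpan ℝ (polyhedronFace u b i) = (ℝ ∙ u i)ᗮ := fun i =>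
    vectorSpan_polyhedronFace (hu i) (by rw [finrank_euclideanSpace_fin]; exact hA i)
  intro i j hij
  obtain ⟨x, hxi⟩ : (polyhedronFace u b i).Nonempty := by
    rw [nonempty_iff_ne_empty]
    intro h
    exact hA i (by rw [h, facetArea, measure_empty])
  have hxj := hij ▸ hxi
  have h1 : u i ∈ (ℝ ∙ u j : Submodule ℝ (EuclideanSpace ℝ (Fin n))) := by
    rw [← Submodule.orthogonal_orthogonal (ℝ ∙ u j), ← hspan j, ← hij, hspan i,
      Submodule.orthogonal_orthogonal]
    exact Submodule.mem_span_singleton_self _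
  obtain ⟨a, ha⟩ := Submodule.mem_span_singleton.1 h1
  have ha1 : |a| = 1 := by simpa [norm_smul, hu] using congrArg norm ha
  rcases (abs_eq zero_le_one).1 ha1 with rfl | rfl
  · exact hinj (by rw [← ha, one_smul])
  · have h2 : inner ℝ (u i) x = b i := hxi.2
    have h3 : inner ℝ (u j) x = b j := hxj.2
    rw [← ha, neg_one_smul, inner_neg_left, h3] at h2
    linarith [hb i, hb j]

end Facets

/-! ### Closing up planar polygons -/

section ClosedPolygons

open Set Module

/-- Greedy choice: each new term gets the sign opposing the current sum. -/
theorem exists_signs_abs_sum_le {ι : Type*} (s : Finset ι) {ℓ : ι → ℝ} {M : ℝ} (hM : 0 ≤ M)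
    (h0 : ∀ i ∈ s, 0 ≤ ℓ i) (hle : ∀ i ∈ s, ℓ i ≤ M) :
    ∃ σ : ι → ℝ, (∀ i, σ i = 1 ∨ σ i = -1) ∧ |∑ i ∈ s, ℓ i * σ i| ≤ M := by
  classical
  induction s using Finset.induction_on with
  | empty => exact ⟨fun _ => 1, fun _ => Or.inl rfl, by simpa using hM⟩
  | insert j s hj ih =>
    obtain ⟨σ, hσ, hs⟩ := ih (fun i hi => h0 i (Finset.mem_insert_of_mem hi))
      (fun i hi => hle i (Finset.mem_insert_of_mem hi))
    have hsum : ∀ ε : ℝ, ∑ i ∈ insert j s, ℓ i * Function.update σ j ε i =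
        ℓ j * ε + ∑ i ∈ s, ℓ i * σ i := fun ε => by
      rw [Finset.sum_insert hj, Function.update_self]
      congr 1
      refine Finset.sum_congr rfl fun i hi => ?_
      rw [Function.update_of_ne (by rintro rfl; exact hj hi)]
    have hupd : ∀ ε : ℝ, (ε = 1 ∨ ε = -1) → ∀ i, Function.update σ j ε i = 1 ∨
        Function.update σ j ε i = -1 := fun ε hε i => by
      rcases eq_or_ne i j with rfl | hi
      · simpa using hε
      · simpa [Function.update_of_ne hi] using hσ i
    have hj0 := h0 j (Finset.mem_insert_self j s)
    have hjM := hle j (Finset.mem_insert_self j s)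
    rw [abs_le] at hs
    rcases le_total 0 (∑ i ∈ s, ℓ i * σ i) with h | h
    · refine ⟨_, hupd (-1) (Or.inr rfl), ?_⟩
      rw [hsum, abs_le]
      constructor <;> linarith
    · refine ⟨_, hupd 1 (Or.inl rfl), ?_⟩
      rw [hsum, abs_le]
      constructor <;> linarith

/-- Segments of lengths `ℓ i` can be chained to span any distance between the greatest of the
lengths and their sum. -/
theorem exists_unit_complex_sum_eq {ι : Type*} [Finite ι] (s : Finset ι) {ℓ : ι → ℝ} {L : ℝ}
    (hL : 0 < L) (h0 : ∀ i ∈ s, 0 ≤ ℓ i) (hle : ∀ i ∈ s, ℓ i ≤ L) (hLs : L ≤ ∑ i ∈ s, ℓ i) :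
    ∃ v : ι → ℂ, (∀ i, ‖v i‖ = 1) ∧ ∑ i ∈ s, (ℓ i : ℂ) * v i = L := by
  have := Fintype.ofFinite ι
  set f : (ι → ℝ) → ℝ := fun θ => ‖∑ i ∈ s, (ℓ i : ℂ) * Complex.exp (θ i * Complex.I)‖ with hf
  have hfc : Continuous f := by fun_prop
  obtain ⟨σ, hσ, hσs⟩ := exists_signs_abs_sum_le s hL.le h0 hle
  -- Signs are the angles 0 and π. Together with all angles 0 they bracket `L` for the intermediate
  -- value theorem.
  have h1 : f (fun i => if σ i = 1 then 0 else Real.pi) ≤ L := by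
    have : ∀ i, Complex.exp (((if σ i = 1 then 0 else Real.pi : ℝ) : ℂ) * Complex.I) =
        (σ i : ℂ) := fun i => by
      rcases hσ i with h | h
      · simp [h]
      · have : ¬ ((-1 : ℝ) = 1) := by norm_num
        simp [h, this, Complex.exp_pi_mul_I]
    simp only [hf, this]
    rw [← Real.norm_eq_abs, ← Complex.norm_real] at hσs
    simpa using hσs
  have h2 : L ≤ f 0 := by
    refine hLs.trans ?_
    simp only [hf, Pi.zero_apply, Complex.ofReal_zero, zero_mul, Complex.exp_zero, mul_one]
    rw [← Complex.ofReal_sum, Complex.norm_real]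
    exact le_abs_self _
  obtain ⟨θ, hθ⟩ := mem_range_of_exists_le_of_exists_ge hfc ⟨_, h1⟩ ⟨_, h2⟩
  set z := ∑ i ∈ s, (ℓ i : ℂ) * Complex.exp (θ i * Complex.I) with hz
  have hzL : ‖z‖ = L := hθ
  have hLC : (L : ℂ) ≠ 0 := Complex.ofReal_ne_zero.2 hL.ne'
  -- A common rotation brings the sum `z`, of modulus `L`, onto the positive real axis.
  refine ⟨fun i => Complex.exp (θ i * Complex.I) * (starRingEnd ℂ z / L), fun i => ?_, ?_⟩
  · rw [norm_mul, Complex.norm_exp_ofReal_mul_I, one_mul, norm_div, RCLike.norm_conj, hzL,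
      Complex.norm_real, Real.norm_eq_abs, abs_of_pos hL, div_self hL.ne']
  · simp only [← mul_assoc]
    rw [← Finset.sum_mul, ← hz, ← mul_div_assoc, Complex.mul_conj, Complex.normSq_eq_norm_sq, hzL,
      div_eq_iff hLC]
    push_cast
    ring

/-- Law of cosines, with `c` the real part of `q`; strict inequalities give `|c| < 1`, hence a
nondegenerate triangle. -/
theorem exists_unit_complex_triangle {A B L : ℝ} (hA : 0 < A) (hB : 0 < B) (hL : 0 < L)
    (h1 : A < B + L) (h2 : B < A + L) (h3 : L < A + B) :
    ∃ p q : ℂ, ‖p‖ = 1 ∧ ‖q‖ = 1 ∧ (A : ℂ) * p + B * q + L = 0 ∧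
      p.re * q.im - p.im * q.re ≠ 0 := by
  set c := (A ^ 2 - B ^ 2 - L ^ 2) / (2 * L * B) with hc
  have hLB : 0 < 2 * L * B := by positivity
  have hcL : c * (2 * L * B) = A ^ 2 - B ^ 2 - L ^ 2 := div_mul_cancel₀ _ hLB.ne'
  have hc1 : c < 1 := by
    rw [hc, div_lt_one hLB]
    nlinarith
  have hc2 : -1 < c := by
    rw [hc, lt_div_iff₀ hLB]
    nlinarith [mul_pos (sub_pos.2 h2) (sub_pos.2 h3)]
  have hpos : 0 < 1 - c ^ 2 := by nlinarith
  set t := Real.sqrt (1 - c ^ 2) with ht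
  have ht2 : t ^ 2 = 1 - c ^ 2 := Real.sq_sqrt hpos.le
  have htpos : 0 < t := Real.sqrt_pos.2 hpos
  have hnorm : ∀ x y : ℝ, x ^ 2 + y ^ 2 = 1 → ‖(⟨x, y⟩ : ℂ)‖ = 1 := fun x y h => by
    rw [← sq_eq_sq₀ (norm_nonneg _) zero_le_one, ← Complex.normSq_eq_norm_sq, Complex.normSq_mk]
    linarith
  refine ⟨⟨-(L + B * c) / A, -(B * t) / A⟩, ⟨c, t⟩, hnorm _ _ ?_, hnorm _ _ (by linarith), ?_, ?_⟩
  · rw [div_pow, div_pow, ← add_div, div_eq_one_iff_eq (by positivity)]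
    linear_combination hcL + B ^ 2 * ht2
  · apply Complex.ext <;> simp <;> field_simp <;> ring
  · have : -(L + B * c) / A * t - -(B * t) / A * c = -(L * t / A) := by ring
    simp only [this]
    exact neg_ne_zero.2 (by positivity)

end ClosedPolygons

/-! ### Balanced spanning offsets -/

section Offsets

open Set Module

theorem exists_balanced_spanning_vectors {d k : ℕ} [NeZero d] (hdk : d ≤ k) {T : ℕ → ℝ}
    (hT : ∀ i ≤ k, 0 < T i) :
    ∃ a : ℕ → EuclideanSpace ℝ (Fin d), ∑ i ∈ Finset.range (k + 1), T i • a i = 0 ∧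
      (∀ i ≤ k, a i ≠ 0) ∧ InjOn a (Iic k) ∧ Submodule.span ℝ (a '' Iic k) = ⊤ ∧
      ∀ i, k < i → a i = 0 := by
  have hd : 0 < d := NeZero.pos d
  -- For `i < k` the `c i` run through all axes since `d ≤ k`. The coordinate sum `φ` takes the
  -- distinct positive values `i + 1` on them and is negative on the balancing vector `a k`, so all
  -- are distinct and nonzero.
  set c : ℕ → EuclideanSpace ℝ (Fin d) := fun i =>
    ((i : ℝ) + 1) • EuclideanSpace.single (Fin.ofNat d (min i (d - 1))) (1 : ℝ) with hc
  set φ : EuclideanSpace ℝ (Fin d) →ₗ[ℝ] ℝ := ∑ l, (EuclideanSpace.proj l).toLinearMap with hφ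
  have hφc : ∀ i, φ (c i) = i + 1 := fun i => by
    simp [hφ, hc, LinearMap.sum_apply]
  set a : ℕ → EuclideanSpace ℝ (Fin d) := fun i => if i < k then c i else if i = k then
    -((T k)⁻¹ • ∑ j ∈ Finset.range k, T j • c j) else 0 with ha
  have hac : ∀ i, i < k → a i = c i := fun i hi => by simp [ha, hi]
  have hak : a k = -((T k)⁻¹ • ∑ j ∈ Finset.range k, T j • c j) := by simp [ha]
  have hφk : φ (a k) < 0 := by
    rw [hak, map_neg, neg_lt_zero, map_smul, map_sum, smul_eq_mul]
    refine mul_pos (inv_pos.2 (hT k le_rfl)) (Finset.sum_pos (fun j hj => ?_) ⟨0, by simp; omega⟩)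
    rw [map_smul, hφc, smul_eq_mul]
    exact mul_pos (hT j (Finset.mem_range.1 hj).le) (by positivity)
  have hφi : ∀ i, i < k → φ (a i) = i + 1 := fun i hi => by rw [hac i hi, hφc]
  refine ⟨a, ?_, fun i hi h => ?_, ?_, ?_, fun i hi => by simp [ha, hi.not_gt, hi.ne']⟩
  · rw [Finset.sum_range_succ, Finset.sum_congr rfl fun i hi => by
      rw [hac i (Finset.mem_range.1 hi)], hak, smul_neg, smul_inv_smul₀ (hT k le_rfl).ne',
      add_neg_cancel]
  · have h0 : φ (a i) = 0 := by rw [h, map_zero]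
    rcases hi.lt_or_eq with hi | rfl
    · rw [hφi i hi] at h0
      have : (0 : ℝ) < i + 1 := by positivity
      linarith
    · linarith
  · intro i hi j hj hij
    have h := congrArg φ hij
    have hpos : ∀ l : ℕ, (0 : ℝ) < l + 1 := fun l => by positivity
    rcases (mem_Iic.1 hi).lt_or_eq with hi | rfl <;> rcases (mem_Iic.1 hj).lt_or_eq with hj | rfl
    · rw [hφi i hi, hφi j hj] at h
      exact_mod_cast add_right_cancel h
    · rw [hφi i hi] at h
      linarith [hpos i]
    · rw [hφi j hj] at h
      linarith [hpos j]
    · rfl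
  · rw [eq_top_iff, ← (EuclideanSpace.basisFun (Fin d) ℝ).toBasis.span_eq, Submodule.span_le]
    rintro _ ⟨l, rfl⟩
    have hl : a l = ((l : ℝ) + 1) • EuclideanSpace.single l (1 : ℝ) := by
      rw [hac _ (by omega), hc]
      have : min (l : ℕ) (d - 1) = l := by omega
      simp [this]
    have hmem := Submodule.smul_mem _ ((l : ℝ) + 1)⁻¹
      (Submodule.subset_span (R := ℝ) (mem_image_of_mem a (mem_Iic.2 (by omega : (l : ℕ) ≤ k))))
    rw [hl, inv_smul_smul₀ (by positivity)] at hmem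
    simpa using hmem

end Offsets

/-! ### Balanced unit normals nearly orthogonal to a line -/

section Normals

open Set Module

/-- Given small offsets `a i`, there are balanced unit vectors in the product of a plane with the
space of the offsets whose second components are the `a i`. -/
theorem exists_unit_normals {ι F : Type*} [Fintype ι] [DecidableEq ι] [NormedAddCommGroup F]
    [InnerProductSpace ℝ F] {S : ι → ℝ} (hS : ∀ i, 0 < S i) {p q : ι} (hpq : p ≠ q)
    (hp : ∀ i, S i ≤ S p) {a : ι → F} (hap : a p = 0) (haq : a q = 0)
    (ha0 : ∀ i, i ≠ p → i ≠ q → a i ≠ 0) (hinj : InjOn a {i | i ≠ p ∧ i ≠ q})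
    (hsum : ∑ i, S i • a i = 0) (hspan : Submodule.span ℝ (range a) = ⊤) {δ : ℝ}
    (hδ1 : δ < 1) (hδ : ∀ i, ‖a i‖ ≤ δ)
    (hlt : S p < S q + (1 - δ) * ∑ i ∈ (Finset.univ.erase p).erase q, S i) :
    ∃ u : ι → WithLp 2 (ℂ × F), (∀ i, ‖u i‖ = 1) ∧ Function.Injective u ∧ ∑ i, S i • u i = 0 ∧
      Submodule.span ℝ (range u) = ⊤ ∧ ∀ i, (u i).snd = a i := by
  set R := (Finset.univ.erase p).erase q with hR
  have hδ0 : 0 ≤ δ := (norm_nonneg _).trans (hδ p)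
  set r : ι → ℝ := fun i => Real.sqrt (1 - ‖a i‖ ^ 2) with hr
  have hr2 : ∀ i, r i ^ 2 = 1 - ‖a i‖ ^ 2 := fun i =>
    Real.sq_sqrt (by nlinarith [norm_nonneg (a i), hδ i])
  have hr1 : ∀ i, r i ≤ 1 := fun i => Real.sqrt_le_one.2 (by nlinarith [norm_nonneg (a i)])
  have hrδ : ∀ i, 1 - δ ≤ r i := fun i =>
    Real.le_sqrt_of_sq_le (by nlinarith [norm_nonneg (a i), hδ i])
  have hr0 : ∀ i, 0 ≤ r i := fun i => Real.sqrt_nonneg _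
  have hsumR : (1 - δ) * ∑ i ∈ R, S i ≤ ∑ i ∈ R, S i * r i := by
    rw [Finset.mul_sum]
    refine Finset.sum_le_sum fun i _ => ?_
    rw [mul_comm]
    exact mul_le_mul_of_nonneg_left (hrδ i) (hS i).le
  -- The cap `S p` keeps the triangle `S p`, `S q`, `L` strict, while `L` still dominates each side
  -- in `R`; `hlt` gives `S p - S q < L`.
  set L := min (∑ i ∈ R, S i * r i) (S p) with hLdef
  have hLq : S p - S q < L := lt_min (by linarith) (by linarith [hS q])
  have hL : 0 < L := by linarith [hp q]
  obtain ⟨v, hv, hvs⟩ := exists_unit_complex_sum_eq R (ℓ := fun i => S i * r i) hL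
    (fun i _ => mul_nonneg (hS i).le (hr0 i))
    (fun i hi => le_min (Finset.single_le_sum (f := fun i => S i * r i)
      (fun j _ => mul_nonneg (hS j).le (hr0 j)) hi)
      ((mul_le_of_le_one_right (hS i).le (hr1 i)).trans (hp i))) (min_le_left _ _)
  obtain ⟨P, Q, hP, hQ, htri, hdet⟩ := exists_unit_complex_triangle (hS p) (hS q) hL
    (by linarith) (by linarith [hp q]) (by linarith [min_le_right (∑ i ∈ R, S i * r i) (S p), hS q])
  set w : ι → ℂ := fun i => if i = p then P else if i = q then Q else v i with hw
  have hwp : w p = P := by simp [hw]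
  have hwq : w q = Q := by simp [hw, hpq.symm]
  have hwn : ∀ i, ‖w i‖ = 1 := fun i => by
    simp only [hw]
    split_ifs
    exacts [hP, hQ, hv i]
  have hrp : r p = 1 := by simp [hr, hap]
  have hrq : r q = 1 := by simp [hr, haq]
  set u : ι → WithLp 2 (ℂ × F) := fun i => WithLp.toLp 2 (r i • w i, a i) with hu
  have hup : u p = WithLp.toLp 2 (P, 0) := by simp [hu, hrp, hwp, hap]
  have huq : u q = WithLp.toLp 2 (Q, 0) := by simp [hu, hrq, hwq, haq]
  refine ⟨u, fun i => ?_, fun i j hij => ?_, ?_, ?_, fun i => rfl⟩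
  · rw [← sq_eq_sq₀ (norm_nonneg _) zero_le_one, WithLp.prod_norm_sq_eq_of_L2]
    change ‖r i • w i‖ ^ 2 + ‖a i‖ ^ 2 = 1 ^ 2
    rw [norm_smul, hwn, mul_one, Real.norm_eq_abs, sq_abs, hr2, sub_add_cancel, one_pow]
  · have haij : a i = a j := congrArg WithLp.snd hij
    have hPQ : u p ≠ u q := fun h => by
      rw [hup, huq] at h
      have : P = Q := congrArg WithLp.fst h
      exact hdet (by rw [this]; ring)
    have hzero : ∀ i, a i = 0 → i = p ∨ i = q := fun i hi => by
      by_contra! h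
      exact ha0 i h.1 h.2 hi
    by_cases h0 : a i = 0
    · rcases hzero i h0 with rfl | rfl <;> rcases hzero j (haij ▸ h0) with rfl | rfl
      · rfl
      · exact absurd hij hPQ
      · exact absurd hij.symm hPQ
      · rfl
    · refine hinj ⟨?_, ?_⟩ ⟨?_, ?_⟩ haij <;> rintro rfl
      · exact h0 hap
      · exact h0 haq
      · exact h0 (haij.trans hap)
      · exact h0 (haij.trans haq)
  · have hfst : ∑ i, S i • r i • w i = 0 := by
      have hqmem : q ∈ Finset.univ.erase p := by simp [hpq.symm]
      have hrest : ∑ i ∈ R, S i • r i • w i = L := by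
        rw [← hvs]
        refine Finset.sum_congr rfl fun i hi => ?_
        have hiq : i ≠ q := Finset.ne_of_mem_erase hi
        have hip : i ≠ p := Finset.ne_of_mem_erase (Finset.mem_of_mem_erase hi)
        simp [hw, hiq, hip, mul_assoc]
      rw [← Finset.add_sum_erase _ _ (Finset.mem_univ p), ← Finset.add_sum_erase _ _ hqmem, ← hR,
        hrest, hrp, hrq, hwp, hwq, one_smul, one_smul, Complex.real_smul, Complex.real_smul,
        ← add_assoc, htri]
    have : ∑ i, S i • u i = WithLp.toLp 2 (∑ i, S i • r i • w i, ∑ i, S i • a i) := by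
      have h := map_sum (WithLp.linearEquiv 2 ℝ (ℂ × F)).symm
        (fun i => (S i • r i • w i, S i • a i)) Finset.univ
      have hpair : (∑ i, S i • r i • w i, ∑ i, S i • a i) =
          ∑ i, ((S i • r i • w i, S i • a i) : ℂ × F) :=
        Prod.ext (by simp [Prod.fst_sum]) (by simp [Prod.snd_sum])
      rw [hpair]
      exact h.symm
    rw [this, hfst, hsum]
    rfl
  · set W := Submodule.span ℝ (range u) with hW
    have hmem : ∀ i, u i ∈ W := fun i => Submodule.subset_span (mem_range_self i)
    have hinl : ∀ z : ℂ, (WithLp.toLp 2 (z, 0) : WithLp 2 (ℂ × F)) ∈ W := fun z => by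
      set D := P.re * Q.im - P.im * Q.re with hD
      -- Cramer's rule in the plane; `D ≠ 0` because the triangle is nondegenerate.
      have hz : (WithLp.toLp 2 (z, 0) : WithLp 2 (ℂ × F)) =
          ((z.re * Q.im - z.im * Q.re) / D) • u p + ((P.re * z.im - P.im * z.re) / D) • u q := by
        rw [hup, huq, ← WithLp.toLp_smul, ← WithLp.toLp_smul, ← WithLp.toLp_add]
        congr 1
        refine Prod.ext (Complex.ext ?_ ?_) (by simp)
        · simp
          field_simp
          rw [hD]
          ring
        · simp
          field_simp
          rw [hD]
          ring
      rw [hz]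
      exact W.add_mem (W.smul_mem _ (hmem p)) (W.smul_mem _ (hmem q))
    have hinr : ∀ y : F, (WithLp.toLp 2 (0, y) : WithLp 2 (ℂ × F)) ∈ W := by
      let g : F →ₗ[ℝ] WithLp 2 (ℂ × F) :=
        (WithLp.linearEquiv 2 ℝ (ℂ × F)).symm.toLinearMap ∘ₗ LinearMap.inr ℝ ℂ F
      have hle : Submodule.span ℝ (range a) ≤ W.comap g := by
        rw [Submodule.span_le]
        rintro _ ⟨i, rfl⟩
        have : g (a i) = u i - WithLp.toLp 2 (r i • w i, 0) := by
          rw [hu, ← WithLp.toLp_sub, Prod.mk_sub_mk, sub_self, sub_zero]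
          rfl
        change g (a i) ∈ W
        rw [this]
        exact W.sub_mem (hmem i) (hinl _)
      intro y
      have hy : y ∈ Submodule.span ℝ (range a) := by rw [hspan]; trivial
      exact hle hy
    rw [eq_top_iff]
    rintro x -
    have hx : x = WithLp.toLp 2 (x.fst, 0) + WithLp.toLp 2 (0, x.snd) := by
      rw [← WithLp.toLp_add, Prod.mk_add_mk, add_zero, zero_add]
      rfl
    rw [hx]
    exact W.add_mem (hinl _) (hinr _)

/-- Balanced unit normals for prescribed areas that are nearly orthogonal to a line. -/
theorem exists_normals_near_hyperplane {d k : ℕ} [NeZero d] (hdk : d ≤ k) {S : ℕ → ℝ}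
    (hS : ∀ i < k + 3, 0 < S i) (hmono : ∀ i < k + 3, S i ≤ S (k + 2))
    (hlt : S (k + 2) < ∑ i ∈ Finset.range (k + 2), S i) {δ : ℝ} (hδ : 0 < δ) :
    ∃ (u : Fin (k + 3) → EuclideanSpace ℝ (Fin (d + 2))) (e : EuclideanSpace ℝ (Fin (d + 2))),
      (∀ i, ‖u i‖ = 1) ∧ Function.Injective u ∧ ∑ i : Fin (k + 3), S i • u i = 0 ∧
      Submodule.span ℝ (range u) = ⊤ ∧ ‖e‖ = 1 ∧ ∀ i, |inner ℝ (u i) e| ≤ δ := by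
  classical
  obtain ⟨a, hasum, ha0, hainj, haspan, haz⟩ :=
    exists_balanced_spanning_vectors hdk (T := S) fun i hi => hS i (by omega)
  set R := ∑ i ∈ Finset.range (k + 1), S i with hR
  have hRpos : 0 < R := Finset.sum_pos (fun i hi => hS i (by simp at hi; omega)) ⟨0, by simp⟩
  rw [Finset.sum_range_succ, ← hR] at hlt
  -- Shortening the sides by the factor `1 - η` costs at most half the slack in `hlt`.
  obtain ⟨η, hη0, hη1, hηδ, hηlt⟩ : ∃ η : ℝ, 0 < η ∧ η < 1 ∧ η ≤ δ ∧
      S (k + 2) < S (k + 1) + (1 - η) * R := by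
    refine ⟨min δ (min (1 / 2) ((R + S (k + 1) - S (k + 2)) / (2 * R))), ?_, ?_, min_le_left _ _, ?_⟩
    · exact lt_min hδ (lt_min (by norm_num) (div_pos (by linarith) (by positivity)))
    · exact ((min_le_right _ _).trans (min_le_left _ _)).trans_lt (by norm_num)
    · have h := (min_le_right δ _).trans
        (min_le_right (1 / 2 : ℝ) ((R + S (k + 1) - S (k + 2)) / (2 * R)))
      rw [le_div_iff₀ (by positivity)] at h
      linarith
  obtain ⟨M, hM⟩ : ∃ M : ℝ, ∀ i : Fin (k + 3), ‖a i‖ ≤ M :=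
    ⟨∑ i : Fin (k + 3), ‖a i‖, fun i =>
      Finset.single_le_sum (f := fun i : Fin (k + 3) => ‖a i‖) (fun _ _ => norm_nonneg _)
        (Finset.mem_univ i)⟩
  have hM0 : 0 ≤ M := (norm_nonneg _).trans (hM 0)
  set s := η / (M + 1) with hs
  have hspos : 0 < s := by positivity
  have hle : ∀ i : Fin (k + 3), ¬ ((i : ℕ) = k + 2) → ¬ ((i : ℕ) = k + 1) → (i : ℕ) ≤ k :=
    fun i h1 h2 => by omega
  have hrest : ∑ i ∈ (Finset.univ.erase (⟨k + 2, by omega⟩ : Fin (k + 3))).erase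
      (⟨k + 1, by omega⟩ : Fin (k + 3)), S i = R := by
    have h1 := Finset.add_sum_erase Finset.univ (fun i : Fin (k + 3) => S i)
      (Finset.mem_univ ⟨k + 2, by omega⟩)
    have h2 := Finset.add_sum_erase (Finset.univ.erase (⟨k + 2, by omega⟩ : Fin (k + 3)))
      (fun i : Fin (k + 3) => S i) (a := ⟨k + 1, by omega⟩) (by simp)
    rw [Fin.sum_univ_eq_sum_range, Finset.sum_range_succ, Finset.sum_range_succ] at h1
    simp only at h1 h2
    linarith
  obtain ⟨u, hu, huinj, husum, huspan, hua⟩ := exists_unit_normals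
    (S := fun i : Fin (k + 3) => S i) (fun i => hS i i.2)
    (p := ⟨k + 2, by omega⟩) (q := ⟨k + 1, by omega⟩) (by simp) (fun i => hmono i i.2)
    (a := fun i => s • a i) (by simp [haz]) (by simp [haz])
    (fun i h1 h2 => smul_ne_zero hspos.ne'
      (ha0 i (hle i (by simpa [Fin.ext_iff] using h1) (by simpa [Fin.ext_iff] using h2))))
    (fun i hi j hj hij => Fin.ext (hainj
      (hle i (by simpa [Fin.ext_iff] using hi.1) (by simpa [Fin.ext_iff] using hi.2))
      (hle j (by simpa [Fin.ext_iff] using hj.1) (by simpa [Fin.ext_iff] using hj.2))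
      (smul_right_injective _ hspos.ne' hij)))
    (by
      simp only [smul_comm _ s]
      rw [← Finset.smul_sum, Fin.sum_univ_eq_sum_range (fun i => S i • a i),
        Finset.sum_range_succ, Finset.sum_range_succ, hasum, haz _ (by omega), haz _ (by omega)]
      simp)
    (by
      rw [eq_top_iff, ← haspan, Submodule.span_le]
      rintro _ ⟨i, hi, rfl⟩
      have hi' : i < k + 3 := by have := mem_Iic.1 hi; omega
      have := Submodule.smul_mem _ s⁻¹ (Submodule.subset_span (R := ℝ)
        (mem_range_self (f := fun i : Fin (k + 3) => s • a i) ⟨i, hi'⟩))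
      simpa [inv_smul_smul₀ hspos.ne'] using this)
    hη1
    (fun i => by
      rw [norm_smul, Real.norm_eq_abs, abs_of_pos hspos, hs, div_mul_eq_mul_div,
        div_le_iff₀ (by positivity)]
      exact mul_le_mul_of_nonneg_left ((hM i).trans (by linarith)) hη0.le)
    (by rw [hrest]; exact hηlt)
  have hrank : finrank ℝ (WithLp 2 (ℂ × EuclideanSpace ℝ (Fin d))) = d + 2 := by
    rw [(WithLp.linearEquiv 2 ℝ (ℂ × EuclideanSpace ℝ (Fin d))).finrank_eq, finrank_prod,
      Complex.finrank_real_complex, finrank_euclideanSpace_fin, add_comm]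
  let Φ : WithLp 2 (ℂ × EuclideanSpace ℝ (Fin d)) ≃ₗᵢ[ℝ] EuclideanSpace ℝ (Fin (d + 2)) :=
    ((stdOrthonormalBasis ℝ _).reindex (finCongr hrank)).repr
  set e : WithLp 2 (ℂ × EuclideanSpace ℝ (Fin d)) :=
    WithLp.toLp 2 (0, EuclideanSpace.single (0 : Fin d) (1 : ℝ)) with he
  have hen : ‖e‖ = 1 := by
    rw [← sq_eq_sq₀ (norm_nonneg _) zero_le_one, WithLp.prod_norm_sq_eq_of_L2]
    simp [he]
  refine ⟨fun i => Φ (u i), Φ e, fun i => by rw [Φ.norm_map, hu],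
    Φ.injective.comp huinj, ?_, ?_, by rw [Φ.norm_map, hen], fun i => ?_⟩
  · simp only [← map_smul]
    rw [← map_sum, husum, map_zero]
  · have : range (fun i => Φ (u i)) = Φ.toLinearEquiv.toLinearMap '' range u := by
      rw [← range_comp]
      rfl
    rw [this, Submodule.span_image, huspan, Submodule.map_top]
    exact Φ.toLinearEquiv.range
  · rw [Φ.inner_map_map, WithLp.prod_inner_apply]
    have h1 : inner ℝ (u i).fst e.fst = 0 := inner_zero_right _
    have h2 : |inner ℝ (u i).snd e.snd| ≤ ‖(u i).snd‖ * ‖e.snd‖ := abs_real_inner_le_norm _ _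
    have h3 : ‖e.snd‖ = 1 := by simp [he]
    rw [h3, hua, mul_one] at h2
    change |inner ℝ (u i).fst e.fst + inner ℝ (u i).snd e.snd| ≤ δ
    rw [h1, zero_add, hua]
    refine h2.trans (le_trans ?_ hηδ)
    rw [norm_smul, Real.norm_eq_abs, abs_of_pos hspos, hs, div_mul_eq_mul_div,
        div_le_iff₀ (by positivity)]
    exact mul_le_mul_of_nonneg_left ((hM i).trans (by linarith)) hη0.le

end Normals

/-! ### Large maximal volume, small rescaled volume -/

section SmallVolume

open Set Module

/-- Balls of radius 1/4 about `k • e`, `k < N`, are disjoint, and on them ⟪u i, x⟫ ≤ 1/4 + N δ < 1.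
-/
theorem mul_volume_ball_le_volume_polyhedron {ι E : Type*} [NormedAddCommGroup E]
    [InnerProductSpace ℝ E] [FiniteDimensional ℝ E] [MeasurableSpace E] [BorelSpace E]
    {u : ι → E} (hu : ∀ i, ‖u i‖ = 1) {e : E} (he : ‖e‖ = 1) {δ : ℝ}
    (hδ : ∀ i, |inner ℝ (u i) e| ≤ δ) {N : ℕ} (hN : N * δ ≤ 1 / 2) :
    N * volume (Metric.ball (0 : E) (1 / 4)) ≤ volume (polyhedron u fun _ => 1) := by
  have hdisj : (↑(Finset.range N) : Set ℕ).PairwiseDisjoint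
      fun k => Metric.ball ((k : ℝ) • e) (1 / 4) := by
    intro k _ l _ hkl
    refine Metric.ball_disjoint_ball ?_
    rw [dist_eq_norm, ← sub_smul, norm_smul, he, mul_one, Real.norm_eq_abs]
    have : (1 : ℝ) ≤ |(k : ℝ) - l| := by
      have h : (1 : ℤ) ≤ |(k : ℤ) - l| := Int.one_le_abs (by omega)
      exact_mod_cast h
    linarith
  have hsub : (⋃ k ∈ Finset.range N, Metric.ball ((k : ℝ) • e) (1 / 4)) ⊆
      polyhedron u fun _ => 1 := by
    refine iUnion₂_subset fun k hk x hx i => ?_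
    have hkN : (k : ℝ) ≤ N := by exact_mod_cast (Finset.mem_range.1 hk).le
    have hδ0 : 0 ≤ δ := (abs_nonneg _).trans (hδ i)
    have h1 : inner ℝ (u i) (x - (k : ℝ) • e) ≤ 1 / 4 := by
      refine (real_inner_le_norm _ _).trans ?_
      rw [hu, one_mul, ← dist_eq_norm]
      exact (Metric.mem_ball.1 hx).le
    have h2 : (k : ℝ) * inner ℝ (u i) e ≤ N * δ :=
      (mul_le_mul_of_nonneg_left ((le_abs_self _).trans (hδ i)) k.cast_nonneg).trans
        (mul_le_mul_of_nonneg_right hkN hδ0)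
    rw [inner_sub_right, inner_smul_right] at h1
    linarith
  calc N * volume (Metric.ball (0 : E) (1 / 4))
      = ∑ k ∈ Finset.range N, volume (Metric.ball ((k : ℝ) • e) (1 / 4)) := by
        simp [Measure.addHaar_ball_center]
    _ = volume (⋃ k ∈ Finset.range N, Metric.ball ((k : ℝ) • e) (1 / 4)) :=
        (measure_biUnion_finset hdisj fun _ _ => measurableSet_ball).symm
    _ ≤ _ := measure_mono hsub

theorem exists_polyhedron_facetArea_eq_volume_le {d k : ℕ} [NeZero d] (hdk : d ≤ k) {S : ℕ → ℝ}
    (hS : ∀ i < k + 3, 0 < S i) (hmono : ∀ i < k + 3, S i ≤ S (k + 2))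
    (hlt : S (k + 2) < ∑ i ∈ Finset.range (k + 2), S i) {ε : ℝ} (hε : 0 < ε) :
    ∃ (u : Fin (k + 3) → EuclideanSpace ℝ (Fin (d + 2))) (b : Fin (k + 3) → ℝ),
      (∀ i, ‖u i‖ = 1) ∧ Function.Injective u ∧ Bornology.IsBounded (polyhedron u b) ∧
      (∀ i, 0 < b i) ∧ (∀ i, facetArea (polyhedronFace u b i) = ENNReal.ofReal (S i)) ∧
      volume (polyhedron u b) ≤ ENNReal.ofReal ε := by
  set n := d + 2 with hn
  have hn0 : (0 : ℝ) < n := by positivity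
  set β := (volume (Metric.ball (0 : EuclideanSpace ℝ (Fin n)) (1 / 4))).toReal with hβ
  have hβ0 : 0 < β := ENNReal.toReal_pos
    (Metric.measure_ball_pos volume _ (by norm_num)).ne' measure_ball_lt_top.ne
  set σ := ∑ i : Fin (k + 3), S i with hσ
  have hσ0 : 0 < σ := Finset.sum_pos (fun i _ => hS i i.2) Finset.univ_nonempty
  -- Chosen so that the maximal `V` is at least `1 / (n (n ε)^(n-1))`, which is the condition `c ≤ n
  -- ε` for the scaling factor below.
  obtain ⟨N, hN⟩ := exists_nat_gt (σ ^ n * (n * (n * ε) ^ (n - 1))⁻¹ / β)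
  have hNpos : 0 < (N : ℝ) := lt_of_le_of_lt (by positivity) hN
  obtain ⟨u, e, hu, hinj, hsum, hspan, he, hue⟩ :=
    exists_normals_near_hyperplane hdk hS hmono hlt (δ := 1 / (2 * N)) (by positivity)
  have hbdd := isBounded_polyhedron (S := fun i : Fin (k + 3) => S i) (fun i => hS i i.2) hsum hspan
  obtain ⟨b, hb, hA, hmax⟩ := exists_polyhedron_area_eq (S := fun i : Fin (k + 3) => S i) hu hinj
    (fun i => hS i i.2) hsum hspan
  rw [finrank_euclideanSpace_fin] at hA hmax
  set V := (volume (polyhedron u b)).toReal with hV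
  have hVlarge : (n * (n * ε) ^ (n - 1))⁻¹ ≤ V := by
    have h1 := hmax (fun _ => 1) fun _ => one_pos
    have h2 := ENNReal.toReal_mono (hbdd _).measure_lt_top.ne
      (mul_volume_ball_le_volume_polyhedron hu he hue (N := N) (by field_simp; norm_num))
    rw [ENNReal.toReal_mul, ENNReal.toReal_natCast, ← hβ] at h2
    simp only [mul_one] at h1
    rw [div_lt_iff₀ hβ0] at hN
    have h3 : σ ^ n * (n * (n * ε) ^ (n - 1))⁻¹ ≤ σ ^ n * V := by
      rw [mul_comm _ V]
      exact hN.le.trans (h2.trans h1)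
    exact le_of_mul_le_mul_left h3 (by positivity)
  have hVpos : 0 < V := lt_of_lt_of_le (by positivity) hVlarge
  obtain ⟨c, hc0, hc⟩ : ∃ c : ℝ, 0 < c ∧ c ^ (n - 1) = (n * V)⁻¹ :=
    ⟨((n * V)⁻¹) ^ (((n - 1 : ℕ) : ℝ)⁻¹), Real.rpow_pos_of_pos (by positivity) _,
      Real.rpow_inv_natCast_pow (by positivity) (by omega)⟩
  have hcε : c ≤ n * ε := by
    refine (pow_le_pow_iff_left₀ hc0.le (by positivity) (by omega : n - 1 ≠ 0)).1 ?_
    rw [hc, inv_le_comm₀ (by positivity) (by positivity)]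
    rw [mul_inv, inv_mul_le_iff₀ hn0] at hVlarge
    exact hVlarge
  refine ⟨u, c • b, hu, hinj, hbdd _, fun i => mul_pos hc0 (hb i), fun i => ?_, ?_⟩
  · rw [facetArea, area_polyhedronFace_smul u b i _ hc0]
    have hfin := area_polyhedronFace_ne_top (hu i) hbdd b
    have hAi := hA i
    rw [finrank_euclideanSpace_fin] at hfin
    rw [← ENNReal.ofReal_toReal hfin, hAi, ← ENNReal.ofReal_mul (by positivity), hc]
    congr 1
    field_simp
    rw [← hn]
  · rw [volume_polyhedron_smul u b hc0, finrank_euclideanSpace_fin,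
      ← ENNReal.ofReal_toReal (hbdd b).measure_lt_top.ne, ← ENNReal.ofReal_mul (by positivity)]
    refine ENNReal.ofReal_le_ofReal ?_
    have : c ^ n * V = c / n := by
      rw [show n = n - 1 + 1 by omega, pow_succ, hc, show n - 1 + 1 = n by omega]
      field_simp
    rw [← hV, this, div_le_iff₀ hn0]
    linarith

theorem hasFacetAreas_polyhedron {n k : ℕ} {S : ℕ → ℝ} {u : Fin k → EuclideanSpace ℝ (Fin n)}
    {b : Fin k → ℝ} (hk : 0 < k) (hu : ∀ i, ‖u i‖ = 1) (hinj : Function.Injective u)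
    (hb : ∀ i, 0 < b i) (hS : ∀ i ∈ Icc 1 k, 0 < S i)
    (hA : ∀ i : Fin k, facetArea (polyhedronFace u b i) = ENNReal.ofReal (S (i + 1))) :
    HasFacetAreas (polyhedron u b) k S := by
  have : Nonempty (Fin k) := ⟨⟨0, hk⟩⟩
  have hA0 : ∀ i, facetArea (polyhedronFace u b i) ≠ 0 := fun i => by
    rw [hA, Ne, ENNReal.ofReal_eq_zero, not_le]
    exact hS _ ⟨by omega, i.2⟩
  have hint : (interior (polyhedron u b)).Nonempty :=
    ⟨0, mem_interior_polyhedron fun i => by simpa using hb i⟩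
  -- Facets are numbered from 1, the normals from 0; values outside `Icc 1 k` are irrelevant.
  have hF : ∀ (i : Fin k), (fun j : ℕ => if h : j - 1 < k then polyhedronFace u b ⟨j - 1, h⟩
      else ∅) ((i : ℕ) + 1) = polyhedronFace u b i := fun i => by simp
  have hidx : ∀ j ∈ Icc 1 k, ∃ i : Fin k, j = i + 1 := fun j hj =>
    ⟨⟨j - 1, by have := hj.1; have := hj.2; omega⟩, by have := hj.1; simp; omega⟩
  refine ⟨fun j => if h : j - 1 < k then polyhedronFace u b ⟨j - 1, h⟩ else ∅, ⟨?_, ?_, ?_⟩, ?_⟩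
  · intro j hj
    obtain ⟨i, rfl⟩ := hidx j hj
    rw [hF, setOf_isFacet_polyhedron hu hint hA0]
    exact mem_range_self i
  · intro j hj l hl hjl
    obtain ⟨i, rfl⟩ := hidx j hj
    obtain ⟨i', rfl⟩ := hidx l hl
    rw [hF, hF] at hjl
    rw [injective_polyhedronFace hu hinj hb hA0 hjl]
  · rw [setOf_isFacet_polyhedron hu hint hA0]
    rintro _ ⟨i, rfl⟩
    exact ⟨i + 1, ⟨by omega, i.2⟩, hF i⟩
  · intro j hj
    obtain ⟨i, rfl⟩ := hidx j hj
    rw [← hA i]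
    exact congrArg facetArea (hF i)

end SmallVolume

theorem theorem2 (m n : ℕ) (hn : 3 ≤ n) (hmn : n < m) (S : ℕ → ℝ)
    (hpos : ∀ i ∈ Set.Icc 1 m, 0 < S i)
    (hmono : MonotoneOn S (Set.Icc 1 m))
    (hlt : S m < ∑ i ∈ Finset.Icc 1 (m - 1), S i) :
    (∀ ε : ℝ, 0 < ε → ∃ P : Set (EuclideanSpace ℝ (Fin n)),
      IsNondegenerateConvexPolytope P ∧ HasFacetAreas P m S ∧ volume P ≤ ENNReal.ofReal ε) ∧
    IsGLB {v : ℝ≥0∞ | ∃ P : Set (EuclideanSpace ℝ (Fin n)),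
      IsNondegenerateConvexPolytope P ∧ HasFacetAreas P m S ∧ volume P = v} 0 := by
  have main : ∀ ε : ℝ, 0 < ε → ∃ P : Set (EuclideanSpace ℝ (Fin n)),
      IsNondegenerateConvexPolytope P ∧ HasFacetAreas P m S ∧ volume P ≤ ENNReal.ofReal ε := by
    intro ε hε
    obtain ⟨d, rfl⟩ : ∃ d, n = d + 2 := ⟨n - 2, by omega⟩
    obtain ⟨k, rfl⟩ : ∃ k, m = k + 3 := ⟨m - 3, by omega⟩
    -- `3 ≤ n` makes room for `e` in the offset space, and `n < m` gives `d ≤ k`, so there are at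
    -- least `d + 1` offsets.
    have : NeZero d := ⟨by omega⟩
    have hsum : ∑ i ∈ Finset.Icc 1 (k + 3 - 1), S i = ∑ i ∈ Finset.range (k + 2), S (i + 1) := by
      have : Finset.Icc 1 (k + 3 - 1) = Finset.Ico 1 (k + 3) := by ext; simp; omega
      rw [this, Finset.sum_Ico_eq_sum_range]
      exact Finset.sum_congr rfl fun i _ => by rw [add_comm]
    obtain ⟨u, b, hu, hinj, hbdd, hb, hA, hV⟩ :=
      exists_polyhedron_facetArea_eq_volume_le (d := d) (k := k) (by omega)
        (S := fun i => S (i + 1)) (fun i hi => hpos _ ⟨by omega, by omega⟩)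
        (fun i hi => hmono ⟨by omega, by omega⟩ ⟨by omega, by omega⟩ (by omega))
        (by rw [← hsum]; exact hlt) hε
    exact ⟨polyhedron u b, ⟨exists_finite_polyhedron_eq_convexHull hbdd,
      0, mem_interior_polyhedron fun i => by simpa using hb i⟩,
      hasFacetAreas_polyhedron (by omega) hu hinj hb hpos hA, hV⟩
  refine ⟨main, fun _ _ => zero_le, fun v hv => ?_⟩
  refine ENNReal.le_of_forall_pos_le_add fun ε hε _ => ?_
  obtain ⟨P, hP, hPS, hPV⟩ := main ε hε
  rw [zero_add, ← ENNReal.ofReal_coe_nnreal]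
  exact (hv ⟨P, hP, hPS, rfl⟩).trans hPV
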